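/- **Proposition 4.2.** A reflexible $4$-maniplex is a pair $\mathcal M=(G,(\rho_0,\rho_1,\rho_2,\rho_3))$, where $G$ is a group generated by the pairwise distinct involutions $\rho_0,\rho_1,\rho_2,\rho_3$, and $\rho_i\rho_j=\rho_j\rho_i$ whenever $|i-j|>1$. Write $G_i=\langle \rho_j \mid j\neq i\rangle$; $G_0$ is the vertex group and $G_3$ the facet group. Two such pairs are isomorphic if some group isomorphism sends the distinguished generators of the first, in order, to those of the second. For $(k,l)\in\{(3,5),(5,3)\}$ let $\{\{k,l\}_5,\{l,k\}_5\}$ denote the pair formed by the group with generators $\rho_0,\rho_1,\rho_2,\rho_3$ and defining relations $$\rho_i^2=(\rho_0\rho_1)^k=(\rho_1\rho_2)^l=(\rho_2\rho_3)^k=(\rho_0\rho_2)^2=(\rho_0\rho_3)^2=(\rho_1\rho_3)^2=(\rho_0\rho_1\rho_2)^5=(\rho_1\rho_2\rho_3)^5=1 ,$$ where $0\le i\le 3$, together with these generators. The $11$-cell is $\{\{3,5\}_5,\{5,3\}_5\}$ (facets hemi-icosahedra, vertex-figures hemi-dodecahedra) and the $57$-cell is $\{\{5,3\}_5,\{3,5\}_5\}$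 (facets hemi-dodecahedra, vertex-figures hemi-icosahedra). Let $q$ be a prime power and let $\mathcal M=(G,(\rho_0,\rho_1,\rho_2,\rho_3))$ be a reflexible $4$-maniplex with $G\cong \mathrm{PSL}_2(q)$ such that each of $G_0$ and $G_3$ is isomorphic to $S_4$ or to $A_5$. Then either $q=11$ and $\mathcal M$ is isomorphic to the $11$-cell, or $q=19$ and $\mathcal M$ is isomorphic to the $57$-cell. In both cases $G_0\cong G_3\cong A_5$. -/

import Mathlib

universe u v

/-- `ρ = (ρ₀, …, ρₙ₋₁)` is a string representation of rank `n` of the group `G`: the `ρᵢ` are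
pairwise distinct involutions generating `G`, and `ρᵢ`, `ρⱼ` commute whenever `|i - j| > 1`. -/
structure IsStringRepresentation {G : Type u} [Group G] {n : ℕ} (ρ : Fin n → G) : Prop where
  orderOf_eq_two : ∀ i, orderOf (ρ i) = 2
  injective : Function.Injective ρ
  commute : ∀ i j : Fin n, (i : ℕ) + 1 < j → Commute (ρ i) (ρ j)
  closure_eq_top : Subgroup.closure (Set.range ρ) = ⊤

/-- A reflexible `n`-maniplex, as a pair `(G, (ρ₀, …, ρₙ₋₁))` consisting of a group (the group of
all automorphisms of the maniplex) and a string representation of it. -/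
structure ReflexibleManiplex (n : ℕ) where
  /-- The automorphism group. -/
  Aut : Type u
  [group : Group Aut]
  /-- The distinguished generators. -/
  ρ : Fin n → Aut
  isStringRepresentation : IsStringRepresentation ρ

namespace ReflexibleManiplex

attribute [instance] ReflexibleManiplex.group

variable {n : ℕ}

/-- The subgroup `Gᵢ = ⟨ρⱼ | j ≠ i⟩`. -/
def faceGroup (M : ReflexibleManiplex.{u} n) (i : Fin n) : Subgroup M.Aut :=
  Subgroup.closure (M.ρ '' {j | j ≠ i})

/-- Two reflexible maniplexes are isomorphic when some group isomorphism sends the distinguished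
generators of the first to those of the second, in order. -/
def IsIsomorphic (M : ReflexibleManiplex.{u} n) (N : ReflexibleManiplex.{v} n) : Prop :=
  ∃ φ : M.Aut ≃* N.Aut, ∀ i, φ (M.ρ i) = N.ρ i

end ReflexibleManiplex

/-- The `i`-th generator of the free group on four letters. -/
def cellGen (i : Fin 4) : FreeGroup (Fin 4) := FreeGroup.of i

/-- The defining relations of the automorphism group of the universal regular polytope
`{{k, l}₅, {l, k}₅}` of rank `4`: those of the Coxeter group `[k, l, k]`, together with
`(ρ₀ρ₁ρ₂)⁵ = 1` (the facets are the maps `{k, l}₅`, with Petrie polygons of length `5`) and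
`(ρ₁ρ₂ρ₃)⁵ = 1` (the vertex-figures are the maps `{l, k}₅`).
The map `{3, 5}₅` is the hemi-icosahedron and `{5, 3}₅` is the hemi-dodecahedron. -/
def cellRels (k l : ℕ) : Set (FreeGroup (Fin 4)) :=
  {cellGen 0 ^ 2, cellGen 1 ^ 2, cellGen 2 ^ 2, cellGen 3 ^ 2,
    (cellGen 0 * cellGen 1) ^ k, (cellGen 1 * cellGen 2) ^ l, (cellGen 2 * cellGen 3) ^ k,
    (cellGen 0 * cellGen 2) ^ 2, (cellGen 0 * cellGen 3) ^ 2, (cellGen 1 * cellGen 3) ^ 2,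
    (cellGen 0 * cellGen 1 * cellGen 2) ^ 5, (cellGen 1 * cellGen 2 * cellGen 3) ^ 5}

/-- The generators of a presented group `⟨ρ₀, ρ₁, ρ₂, ρ₃ | cellRels k l⟩` form a string
representation as soon as the relations hold for four distinct nontrivial elements of some
group. -/
theorem isStringRepresentation_cell {k l : ℕ} {H : Type} [Group H] (f : Fin 4 → H)
    (hf : ∀ r ∈ cellRels k l, FreeGroup.lift f r = 1) (hne : ∀ i, f i ≠ 1)
    (hinj : Function.Injective f) :
    IsStringRepresentation
      (fun i : Fin 4 => (PresentedGroup.of i : PresentedGroup (cellRels k l))) := by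
  have himg : ∀ i, PresentedGroup.toGroup hf (PresentedGroup.of i) = f i := fun i =>
    PresentedGroup.toGroup.of hf
  have hone : ∀ r ∈ cellRels k l, PresentedGroup.mk (cellRels k l) r = 1 := fun r hr =>
    PresentedGroup.one_of_mem hr
  have hsq : ∀ i : Fin 4, (PresentedGroup.of i : PresentedGroup (cellRels k l)) ^ 2 = 1 := by
    intro i
    refine hone (cellGen i ^ 2) ?_
    fin_cases i <;> simp [cellRels]
  have hcomm : ∀ i j : Fin 4, cellGen i * cellGen j ∈ ({cellGen 0 * cellGen 2,
      cellGen 0 * cellGen 3, cellGen 1 * cellGen 3} : Set (FreeGroup (Fin 4))) →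
      Commute (PresentedGroup.of i : PresentedGroup (cellRels k l)) (PresentedGroup.of j) := by
    intro i j hij
    have h : ((PresentedGroup.of i : PresentedGroup (cellRels k l)) * PresentedGroup.of j) ^ 2
        = 1 := by
      refine hone ((cellGen i * cellGen j) ^ 2) ?_
      rcases hij with h | h | h <;> rw [h] <;> simp [cellRels]
    have hi := hsq i
    have hj := hsq j
    rw [sq] at hi hj h
    have e := mul_eq_one_iff_eq_inv.mp h
    rw [mul_inv_rev, ← mul_eq_one_iff_eq_inv.mp hi, ← mul_eq_one_iff_eq_inv.mp hj] at e
    exact e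
  refine ⟨fun i => orderOf_eq_prime (hsq i) ?_, ?_, ?_, PresentedGroup.closure_range_of _⟩
  · intro h
    apply hne i
    rw [← himg i, h, map_one]
  · intro i j h
    apply hinj
    rw [← himg i, ← himg j]
    exact congrArg _ h
  · intro i j hij
    apply hcomm
    fin_cases i <;> fin_cases j <;> simp_all

/-- Four permutations of `11` points satisfying the relations of the `11`-cell. -/
def elevenPerm : Fin 4 → Equiv.Perm (Fin 11) :=
  ![Function.Involutive.toPerm ![1, 0, 2, 3, 5, 4, 6, 10, 9, 8, 7]
      (by unfold Function.Involutive; decide),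
    Function.Involutive.toPerm ![0, 2, 1, 4, 3, 5, 7, 6, 9, 8, 10]
      (by unfold Function.Involutive; decide),
    Function.Involutive.toPerm ![0, 1, 3, 2, 5, 4, 6, 8, 7, 10, 9]
      (by unfold Function.Involutive; decide),
    Function.Involutive.toPerm ![0, 1, 2, 6, 7, 10, 3, 4, 9, 8, 5]
      (by unfold Function.Involutive; decide)]

/-- Four permutations of `20` points satisfying the relations of the `57`-cell. -/
def fiftySevenPerm : Fin 4 → Equiv.Perm (Fin 20) :=
  ![Function.Involutive.toPerm
      ![1, 0, 3, 2, 17, 18, 8, 12, 6, 13, 15, 19, 7, 9, 16, 10, 14, 4, 5, 11]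
      (by unfold Function.Involutive; decide),
    Function.Involutive.toPerm
      ![7, 10, 6, 18, 14, 17, 2, 0, 16, 11, 1, 9, 19, 15, 4, 13, 8, 5, 3, 12]
      (by unfold Function.Involutive; decide),
    Function.Involutive.toPerm
      ![5, 18, 6, 8, 19, 0, 2, 9, 3, 7, 16, 17, 13, 12, 15, 14, 10, 11, 1, 4]
      (by unfold Function.Involutive; decide),
    Function.Involutive.toPerm
      ![4, 17, 9, 13, 0, 10, 11, 14, 19, 2, 5, 6, 16, 3, 7, 18, 12, 1, 15, 8]
      (by unfold Function.Involutive; decide)]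

set_option maxRecDepth 100000 in
/-- The distinguished generators of the `11`-cell form a string representation. -/
theorem isStringRepresentation_elevenCell :
    IsStringRepresentation
      (fun i : Fin 4 => (PresentedGroup.of i : PresentedGroup (cellRels 3 5))) := by
  refine isStringRepresentation_cell elevenPerm ?_ ?_ ?_
  · intro r hr
    simp only [cellRels, Set.mem_insert_iff, Set.mem_singleton_iff] at hr
    rcases hr with h | h | h | h | h | h | h | h | h | h | h | h <;> rw [h] <;>
      simp only [cellGen, map_mul, FreeGroup.lift_apply_of, pow_succ, pow_zero, one_mul] <;>
      refine Equiv.ext ?_ <;> decide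
  · intro i h
    have h' := DFunLike.congr_fun h
    revert h'
    revert i
    decide
  · intro i j h
    have h' := DFunLike.congr_fun h
    clear h
    revert i j
    decide

set_option maxRecDepth 100000 in
/-- The distinguished generators of the `57`-cell form a string representation. -/
theorem isStringRepresentation_fiftySevenCell :
    IsStringRepresentation
      (fun i : Fin 4 => (PresentedGroup.of i : PresentedGroup (cellRels 5 3))) := by
  refine isStringRepresentation_cell fiftySevenPerm ?_ ?_ ?_
  · intro r hr
    simp only [cellRels, Set.mem_insert_iff, Set.mem_singleton_iff] at hr
    rcases hr with h | h | h | h | h | h | h | h | h | h | h | h <;> rw [h] <;>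
      simp only [cellGen, map_mul, FreeGroup.lift_apply_of, pow_succ, pow_zero, one_mul] <;>
      refine Equiv.ext ?_ <;> decide
  · intro i h
    have h' := DFunLike.congr_fun h
    clear h
    revert i
    decide
  · intro i j h
    have h' := DFunLike.congr_fun h
    clear h
    revert i j
    decide

/-- The `11`-cell `{{3, 5}₅, {5, 3}₅}`: the universal regular `4`-polytope whose facets are
hemi-icosahedra and whose vertex-figures are hemi-dodecahedra. -/
def elevenCell : ReflexibleManiplex.{0} 4 where
  Aut := PresentedGroup (cellRels 3 5)
  ρ i := PresentedGroup.of i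
  isStringRepresentation := isStringRepresentation_elevenCell

/-- The `57`-cell `{{5, 3}₅, {3, 5}₅}`: the universal regular `4`-polytope whose facets are
hemi-dodecahedra and whose vertex-figures are hemi-icosahedra. -/
def fiftySevenCell : ReflexibleManiplex.{0} 4 where
  Aut := PresentedGroup (cellRels 5 3)
  ρ i := PresentedGroup.of i
  isStringRepresentation := isStringRepresentation_fiftySevenCell

/-!
Lift the generators `ρ₀, …, ρ₃` to `A₀, …, A₃` in `SL₂(F)`. A nontrivial element of `PSL₂(F)` is
an involution exactly if its lifts are traceless (in any characteristic), so the `Aᵢ` are four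
vectors of norm one in the three-dimensional quadratic space of traceless matrices, and `Aᵢ ⟂ Aⱼ`
for `|i - j| > 1`. With `X`, `Y`, `Z`, `W`, `V` for the squared traces of `A₀A₁`, `A₁A₂`, `A₂A₃`,
`A₀A₁A₂`, `A₁A₂A₃`, the Gram matrix of the four vectors is singular (`four_sub_mul_four_sub`), and
the triples `A₀, A₁, A₂` and `A₁, A₂, A₃` satisfy a Pythagorean relation (`trace_mul_mul_sq`):

  `(4 - X) * (4 - Z) = 4 * Y`,  `X + Y + W = 4`,  `Y + Z + V = 4`.

As `S₄` and `A₅` have trivial centre, none of the five elements is trivial or an involution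
(`CenterlessTriple`), and the squared trace of an element determines whether its order is `3`, `4`
or `5`: it is then `1`, `2`, or a root of `t ^ 2 - 3 * t + 1`. For a facet group or vertex group
`S₄` the values are thus `1` or `2`, and for `A₅` they are `1` or a root. In characteristic two
the Gram relation gives `X * Z = 0`, which is excluded. Otherwise elementary algebra leaves the
following possibilities.

* Both groups are `S₄` and the type is `{3, 3, 3}` or `{4, 3, 4}`. Then `2` is a square in `F`, so
  that `7 ≤ |F|` and `168 ≤ |PSL₂(F)|`, while the relations allow at most `5 · 24` elements.
* Both groups are `A₅`, the type is `{3, 5, 3}`, all relations of the `11`-cell hold, and `11 = 0`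
  in `F`.
* Both groups are `A₅`, the type is `{5, 3, 5}`, all relations of the `57`-cell hold, and `19 = 0`
  in `F`.

The groups of the two cells have at most `11 · 60` and `57 · 60` elements. These are the orders of
`PSL₂(11)` and `PSL₂(19)`, so comparing orders gives `|F|` and the isomorphism at once.

The bounds on finitely presented groups come from coset enumeration: `CosetEnumeration.completes`
is a checker for completed coset tables whose correctness is proved once (`exists_point_eq`) and
which the kernel evaluates.
-/

/-! ### Coset enumeration -/

namespace CosetEnumeration

/-- A partial coset table: the entry `(i, g, j)` says that the generator number `g` sends the
coset number `i` to the coset number `j`. -/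
abbrev Table := List (ℕ × ℕ × ℕ)

/-- The image of the coset `i` under the generator `g`, if the table lists it. -/
def target : Table → ℕ → ℕ → Option ℕ
  | [], _, _ => none
  | e :: T, i, g => bif Nat.beq e.1 i && Nat.beq e.2.1 g then some e.2.2 else target T i g

/-- The image of the coset `i` under the word `w`, acting from the left, so that the last letter
acts first. -/
def trace (T : Table) : List ℕ → ℕ → Option ℕ
  | [], i => some i
  | g :: w, i => (trace T w i).bind fun j => target T j g

/-- Extension of the table by a deduction: `(a, r, s)` stands for the `r`-th relator rotated by `s`
letters, `g :: w`. If `w` sends `a` to `b`, then `g` sends `b` back to `a`. -/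
def deduce (R : List (List ℕ)) (T : Table) (c : ℕ × ℕ × ℕ) : Table :=
  match (R.getD c.2.1 []).rotate c.2.2 with
  | [] => T
  | g :: w =>
    match trace T w c.1 with
    | none => T
    | some b => (b, g, c.1) :: (c.1, g, b) :: T

/-- The table expressing that the generators in `S` fix the coset `0`, and that the coset `k + 1` is
defined as the image of the coset `(d k).1` under the generator `(d k).2`. -/
def initial (S : List ℕ) (d : List (ℕ × ℕ)) : Table :=
  S.map (fun g => (0, g, 0)) ++
    (List.range d.length).flatMap fun k =>
      [((d.getD k (0, 0)).1, (d.getD k (0, 0)).2, k + 1),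
        (k + 1, (d.getD k (0, 0)).2, (d.getD k (0, 0)).1)]

/-- Whether the deductions `c` complete the table started by `S` and `d`, for the generators
numbered `0, …, m - 1`. -/
def completes (m : ℕ) (R : List (List ℕ)) (S : List ℕ) (d : List (ℕ × ℕ))
    (c : List (ℕ × ℕ × ℕ)) : Bool :=
  (List.range d.length).all (fun k => Nat.ble (d.getD k (0, 0)).1 k) &&
    (List.range (d.length + 1)).all fun i => (List.range m).all fun g =>
      match target (c.foldl (deduce R) (initial S d)) i g with
      | none => false
      | some j => Nat.ble j d.length

variable {G X : Type*} [Group G] [MulAction G X]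

/-- The table `T` is correct when the coset number `i` is read as the point `x i`. -/
def Sound (ρ : ℕ → G) (x : ℕ → X) (T : Table) : Prop :=
  ∀ e ∈ T, ρ e.2.1 • x e.1 = x e.2.2

theorem Sound.target {ρ : ℕ → G} {x : ℕ → X} {T : Table} (h : Sound ρ x T) {i g j : ℕ}
    (hj : target T i g = some j) : ρ g • x i = x j := by
  induction T with
  | nil => simp [CosetEnumeration.target] at hj
  | cons e T ih =>
    rw [CosetEnumeration.target] at hj
    cases hb : Nat.beq e.1 i && Nat.beq e.2.1 g with
    | false =>
      rw [hb, cond_false] at hj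
      exact ih (fun e he => h e (List.mem_cons_of_mem _ he)) hj
    | true =>
      rw [hb, cond_true, Option.some.injEq] at hj
      rw [Bool.and_eq_true, Nat.beq_eq, Nat.beq_eq] at hb
      rw [← hb.1, ← hb.2, ← hj]
      exact h e List.mem_cons_self

theorem Sound.trace {ρ : ℕ → G} {x : ℕ → X} {T : Table} (h : Sound ρ x T) {w : List ℕ}
    {i j : ℕ} (hj : trace T w i = some j) : (w.map ρ).prod • x i = x j := by
  induction w generalizing j with
  | nil =>
    rw [CosetEnumeration.trace, Option.some.injEq] at hj
    simp [hj]
  | cons g w ih =>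
    rw [CosetEnumeration.trace, Option.bind_eq_some_iff] at hj
    obtain ⟨k, hk, hkj⟩ := hj
    rw [List.map_cons, List.prod_cons, mul_smul, ih hk, h.target hkj]

theorem prod_rotate_eq_one {l : List G} (h : l.prod = 1) (s : ℕ) : (l.rotate s).prod = 1 := by
  induction s generalizing l with
  | zero => simpa using h
  | succ s ih =>
    cases l with
    | nil => simp
    | cons a l =>
      rw [List.rotate_cons_succ]
      apply ih
      rw [List.prod_append, List.prod_singleton]
      rw [List.prod_cons] at h
      exact mul_eq_one_comm.mp h

theorem Sound.deduce {ρ : ℕ → G} {x : ℕ → X} {T : Table} (h : Sound ρ x T)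
    (hρ : ∀ g, ρ g * ρ g = 1) {R : List (List ℕ)} (hR : ∀ w ∈ R, (w.map ρ).prod = 1)
    (c : ℕ × ℕ × ℕ) : Sound ρ x (deduce R T c) := by
  have hrel : (((R.getD c.2.1 []).rotate c.2.2).map ρ).prod = 1 := by
    rw [List.map_rotate]
    apply prod_rotate_eq_one
    rw [List.getD_eq_getElem?_getD]
    cases hr : R[c.2.1]? with
    | none => simp
    | some w => simpa using hR w (List.mem_of_getElem? hr)
  unfold CosetEnumeration.deduce
  split
  · exact h
  · rename_i g w hw
    rw [hw, List.map_cons, List.prod_cons] at hrel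
    split
    · exact h
    · rename_i b hb
      have key : ρ g • x b = x c.1 := by
        rw [← h.trace hb, ← mul_smul, hrel, one_smul]
      intro e he
      rcases List.mem_cons.mp he with rfl | he
      · exact key
      rcases List.mem_cons.mp he with rfl | he
      · change ρ g • x c.1 = x b
        rw [← key, ← mul_smul, hρ, one_smul]
      · exact h e he

/-- The points numbered by the definitions `d`, starting at `x₀`. -/
def point (ρ : ℕ → G) (x₀ : X) (d : List (ℕ × ℕ)) : ℕ → X
  | 0 => x₀
  | k + 1 =>
    if _h : (d.getD k (0, 0)).1 < k + 1 then
      ρ (d.getD k (0, 0)).2 • point ρ x₀ d (d.getD k (0, 0)).1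
    else x₀
termination_by k => k
decreasing_by exact _h

theorem sound_initial {ρ : ℕ → G} (hρ : ∀ g, ρ g * ρ g = 1) {x₀ : X} {S : List ℕ}
    (hS : ∀ g ∈ S, ρ g • x₀ = x₀) {d : List (ℕ × ℕ)}
    (hd : ∀ k < d.length, (d.getD k (0, 0)).1 ≤ k) :
    Sound ρ (point ρ x₀ d) (initial S d) := by
  intro e he
  rw [initial, List.mem_append, List.mem_map, List.mem_flatMap] at he
  rcases he with ⟨g, hg, rfl⟩ | ⟨k, hk, he⟩
  · simpa only [point] using hS g hg
  · have hp : point ρ x₀ d (k + 1) =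
        ρ (d.getD k (0, 0)).2 • point ρ x₀ d (d.getD k (0, 0)).1 := by
      rw [point, dif_pos (Nat.lt_succ_of_le (hd k (List.mem_range.mp hk)))]
    rcases List.mem_pair.mp he with rfl | rfl
    · exact hp.symm
    · change ρ (d.getD k (0, 0)).2 • point ρ x₀ d (k + 1) = _
      rw [hp, ← mul_smul, hρ, one_smul]

/-- A completed coset table lists the whole orbit of `x₀`: its rows form a set that contains `x₀`
and is closed under the generators. -/
theorem exists_point_eq {m : ℕ} {R : List (List ℕ)} {S : List ℕ} {d : List (ℕ × ℕ)}
    {c : List (ℕ × ℕ × ℕ)} (hc : completes m R S d c = true) {ρ : ℕ → G}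
    (hρ : ∀ g, ρ g * ρ g = 1) (hR : ∀ w ∈ R, (w.map ρ).prod = 1) {x₀ : X}
    (hS : ∀ g ∈ S, ρ g • x₀ = x₀) {h : G} (hh : h ∈ Subgroup.closure (ρ '' {g | g < m})) :
    ∃ i : Fin (d.length + 1), point ρ x₀ d i = h • x₀ := by
  rw [completes, Bool.and_eq_true, List.all_eq_true, List.all_eq_true] at hc
  obtain ⟨hd, hc⟩ := hc
  have hsound : Sound ρ (point ρ x₀ d) (c.foldl (deduce R) (initial S d)) := by
    have h0 := sound_initial hρ hS fun k hk => Nat.le_of_ble_eq_true (hd k (List.mem_range.mpr hk))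
    generalize initial S d = T at h0
    clear hc
    induction c generalizing T with
    | nil => exact h0
    | cons a c ih => exact ih _ (h0.deduce hρ hR a)
  have hgen : ∀ g < m, ∀ y ∈ Set.range fun i : Fin (d.length + 1) => point ρ x₀ d i,
      ρ g • y ∈ Set.range fun i : Fin (d.length + 1) => point ρ x₀ d i := by
    rintro g hg _ ⟨i, rfl⟩
    have := List.all_eq_true.mp (hc i (List.mem_range.mpr i.2)) g (List.mem_range.mpr hg)
    split at this
    · cases this
    · rename_i j hj
      exact ⟨⟨j, Nat.lt_succ_of_le (Nat.le_of_ble_eq_true this)⟩, (hsound.target hj).symm⟩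
  have key : ∀ y ∈ Set.range fun i : Fin (d.length + 1) => point ρ x₀ d i,
      h • y ∈ (Set.range fun i : Fin (d.length + 1) => point ρ x₀ d i) ∧
        h⁻¹ • y ∈ Set.range fun i : Fin (d.length + 1) => point ρ x₀ d i := by
    induction hh using Subgroup.closure_induction with
    | mem h hh =>
      obtain ⟨g, hg, rfl⟩ := hh
      rw [inv_eq_of_mul_eq_one_left (hρ g)]
      exact fun y hy => ⟨hgen g hg y hy, hgen g hg y hy⟩
    | one => simp
    | mul a b _ _ ha hb =>
      intro y hy
      rw [mul_inv_rev, mul_smul, mul_smul]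
      exact ⟨(ha _ (hb y hy).1).1, (hb _ (ha y hy).2).2⟩
    | inv a _ ha =>
      intro y hy
      rw [inv_inv]
      exact (ha y hy).symm
  exact (key x₀ ⟨0, by simp [point]⟩).1

/-- Enumeration of the cosets of the trivial subgroup bounds the order of a generated subgroup. -/
theorem finite_and_card_closure_le {m : ℕ} {R : List (List ℕ)} {d : List (ℕ × ℕ)}
    {c : List (ℕ × ℕ × ℕ)} (hc : completes m R [] d c = true) {ρ : ℕ → G}
    (hρ : ∀ g, ρ g * ρ g = 1) (hR : ∀ w ∈ R, (w.map ρ).prod = 1) :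
    Finite (Subgroup.closure (ρ '' {g | g < m})) ∧
      Nat.card (Subgroup.closure (ρ '' {g | g < m})) ≤ d.length + 1 := by
  choose f hf using fun h : Subgroup.closure (ρ '' {g | g < m}) =>
    exists_point_eq hc hρ hR (x₀ := (1 : G)) (fun g hg => by simp at hg) h.2
  have hinj : Function.Injective f := fun a b hab => by
    have ha := hf a
    rw [hab, hf b] at ha
    simpa using ha.symm
  exact ⟨Finite.of_injective f hinj, by simpa using Nat.card_le_card_of_injective f hinj⟩

/-- Enumeration of the cosets of the subgroup `H` containing the generators in `S` bounds the index
of `H`. -/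
theorem finite_and_card_quotient_le {m : ℕ} {R : List (List ℕ)} {S : List ℕ} {d : List (ℕ × ℕ)}
    {c : List (ℕ × ℕ × ℕ)} (hc : completes m R S d c = true) {ρ : ℕ → G}
    (hρ : ∀ g, ρ g * ρ g = 1) (hR : ∀ w ∈ R, (w.map ρ).prod = 1) {H : Subgroup G}
    (hS : ∀ g ∈ S, ρ g ∈ H) (htop : Subgroup.closure (ρ '' {g | g < m}) = ⊤) :
    Finite (G ⧸ H) ∧ Nat.card (G ⧸ H) ≤ d.length + 1 := by
  have hS' : ∀ g ∈ S, ρ g • ((1 : G) : G ⧸ H) = ((1 : G) : G ⧸ H) := fun g hg => by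
    rw [MulAction.Quotient.smul_coe, smul_eq_mul, mul_one, QuotientGroup.eq]
    simpa using hS g hg
  have hsurj : Function.Surjective
      fun i : Fin (d.length + 1) => point ρ ((1 : G) : G ⧸ H) d i := by
    intro y
    obtain ⟨h, rfl⟩ := QuotientGroup.mk_surjective y
    obtain ⟨i, hi⟩ := exists_point_eq hc hρ hR hS' (h := h) (htop ▸ Subgroup.mem_top h)
    exact ⟨i, by simpa using hi⟩
  exact ⟨Finite.of_surjective _ hsurj, by simpa using Nat.card_le_card_of_surjective _ hsurj⟩

end CosetEnumeration

/-! ### Orders of groups with two-sided Petrie relations -/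

section CellRelations

variable {G : Type*} [Group G]

/-- The relations of `{{k, l}ₐ, {l, k}ₐ}`: those of the Coxeter group `[k, l, k]`, and Petrie
polygons of length `a` for the facets and the vertex-figures. -/
structure CellRelations (ρ : Fin 4 → G) (k l a : ℕ) : Prop where
  sq : ∀ i, ρ i ^ 2 = 1
  pow01 : (ρ 0 * ρ 1) ^ k = 1
  pow12 : (ρ 1 * ρ 2) ^ l = 1
  pow23 : (ρ 2 * ρ 3) ^ k = 1
  pow02 : (ρ 0 * ρ 2) ^ 2 = 1
  pow03 : (ρ 0 * ρ 3) ^ 2 = 1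
  pow13 : (ρ 1 * ρ 3) ^ 2 = 1
  pow012 : (ρ 0 * ρ 1 * ρ 2) ^ a = 1
  pow123 : (ρ 1 * ρ 2 * ρ 3) ^ a = 1

/-- The word `w ^ k`. -/
def wordPow (w : List ℕ) (k : ℕ) : List ℕ := (List.replicate k w).flatten

/-- The relators of the facet group `{k, l}ₐ` other than the squares of the generators. -/
def facetWords (k l a : ℕ) : List (List ℕ) :=
  [wordPow [0, 1] k, wordPow [1, 2] l, wordPow [0, 2] 2, wordPow [0, 1, 2] a]

/-- The relators of `{{k, l}ₐ, {l, k}ₐ}` other than the squares of the generators. -/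
def cellWords (k l a : ℕ) : List (List ℕ) :=
  facetWords k l a ++
    [wordPow [2, 3] k, wordPow [0, 3] 2, wordPow [1, 3] 2, wordPow [1, 2, 3] a]

/-- The generators indexed by natural numbers modulo `4`, as coset enumeration numbers them. -/
def natGen {G : Type*} (ρ : Fin 4 → G) (n : ℕ) : G := ρ (Fin.ofNat 4 n)

theorem prod_map_wordPow (f : ℕ → G) (w : List ℕ) (k : ℕ) :
    ((wordPow w k).map f).prod = (w.map f).prod ^ k := by
  induction k with
  | zero => simp [wordPow]
  | succ k ih =>
    rw [wordPow] at ih ⊢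
    rw [List.replicate_succ, List.flatten_cons, List.map_append, List.prod_append, ih, pow_succ']

theorem CellRelations.mul_self {ρ : Fin 4 → G} {k l a : ℕ} (h : CellRelations ρ k l a) (n : ℕ) :
    natGen ρ n * natGen ρ n = 1 := by
  rw [← _root_.sq]
  exact h.sq _

theorem CellRelations.prod_facetWords {ρ : Fin 4 → G} {k l a : ℕ} (h : CellRelations ρ k l a) :
    ∀ w ∈ facetWords k l a, (w.map (natGen ρ)).prod = 1 := by
  simpa [facetWords, prod_map_wordPow, natGen, ← mul_assoc] using
    ⟨h.pow01, h.pow12, h.pow02, h.pow012⟩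

theorem CellRelations.prod_cellWords {ρ : Fin 4 → G} {k l a : ℕ} (h : CellRelations ρ k l a) :
    ∀ w ∈ cellWords k l a, (w.map (natGen ρ)).prod = 1 := by
  intro w hw
  rw [cellWords, List.mem_append] at hw
  rcases hw with hw | hw
  · exact h.prod_facetWords w hw
  · revert w
    simpa [prod_map_wordPow, natGen, ← mul_assoc] using
      ⟨h.pow23, h.pow03, h.pow13, h.pow123⟩

theorem image_natGen_lt_four {G : Type*} (ρ : Fin 4 → G) :
    natGen ρ '' {n | n < 4} = Set.range ρ := by
  ext y
  constructor
  · rintro ⟨n, -, rfl⟩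
    exact ⟨_, rfl⟩
  · rintro ⟨i, rfl⟩
    exact ⟨i, i.2, by simp [natGen]⟩

theorem image_natGen_lt_three {G : Type*} (ρ : Fin 4 → G) :
    natGen ρ '' {n | n < 3} = ρ '' {j | j ≠ 3} := by
  ext y
  constructor
  · rintro ⟨n, hn, rfl⟩
    refine ⟨Fin.ofNat 4 n, ?_, rfl⟩
    rw [Set.mem_ofPred_eq] at hn
    interval_cases n <;> decide
  · rintro ⟨i, hi, rfl⟩
    refine ⟨i, ?_, by simp [natGen]⟩
    revert hi
    revert i
    decide

theorem natGen_mem_facetGroup (ρ : Fin 4 → G) :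
    ∀ n ∈ [0, 1, 2], natGen ρ n ∈ Subgroup.closure (ρ '' {j | j ≠ 3}) := by
  intro n hn
  rw [← image_natGen_lt_three]
  refine Subgroup.subset_closure ⟨n, ?_, rfl⟩
  revert n
  decide

/-! The lists given as `d` and `c` are the coset definitions and the deductions of coset
enumerations that close up without coincidences. -/

theorem finite_and_card_facetGroup_le_eleven {ρ : Fin 4 → G} (h : CellRelations ρ 3 5 5) :
    Finite (Subgroup.closure (ρ '' {j | j ≠ 3})) ∧
      Nat.card (Subgroup.closure (ρ '' {j | j ≠ 3})) ≤ 60 := by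
  rw [← image_natGen_lt_three]
  exact CosetEnumeration.finite_and_card_closure_le (R := facetWords 3 5 5)
    (d :=
      [(0, 0), (0, 1), (0, 2), (1, 1), (1, 2), (2, 0), (2, 2), (3, 1), (4, 0), (4, 2), (5, 1),
      (6, 2), (7, 1), (8, 0), (8, 2), (9, 2), (10, 1), (11, 0), (11, 2), (12, 1), (13, 0),
      (13, 2), (14, 2), (15, 1), (16, 1), (17, 0), (17, 2), (18, 2), (19, 1), (20, 0),
      (20, 2), (21, 2), (22, 1), (23, 1), (24, 0), (25, 0), (25, 2), (26, 2), (27, 1),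
      (28, 1), (29, 0), (30, 2), (31, 1), (32, 1), (33, 0), (34, 0), (34, 2), (36, 2),
      (37, 1), (38, 1), (39, 0), (40, 0), (40, 2), (42, 1), (43, 0), (44, 0), (44, 2),
      (46, 2), (47, 1)])
    (c :=
      [(3, 2, 0), (6, 0, 1), (7, 2, 0), (10, 2, 0), (14, 0, 1), (15, 2, 0), (19, 2, 0),
      (21, 0, 1), (22, 2, 0), (24, 1, 1), (26, 0, 1), (27, 2, 0), (29, 1, 1), (31, 2, 0),
      (35, 0, 1), (35, 2, 1), (37, 2, 0), (41, 0, 1), (41, 2, 1), (43, 1, 1), (45, 0, 1),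
      (47, 2, 0), (48, 3, 1), (49, 0, 0), (50, 1, 1), (50, 2, 0), (51, 0, 1), (52, 1, 1),
      (53, 2, 0), (55, 0, 1), (55, 1, 1)])
    (by decide +kernel) h.mul_self h.prod_facetWords

theorem finite_and_index_facetGroup_le_eleven {ρ : Fin 4 → G} (h : CellRelations ρ 3 5 5)
    (htop : Subgroup.closure (Set.range ρ) = ⊤) :
    Finite (G ⧸ Subgroup.closure (ρ '' {j | j ≠ 3})) ∧
      Nat.card (G ⧸ Subgroup.closure (ρ '' {j | j ≠ 3})) ≤ 11 :=
  CosetEnumeration.finite_and_card_quotient_le (R := cellWords 3 5 5) (S := [0, 1, 2]) (m := 4)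
    (d :=
      [(0, 3), (1, 2), (2, 1), (3, 0), (3, 2), (4, 2), (5, 1), (6, 1), (6, 3), (8, 0)])
    (c :=
      [(1, 5, 0), (1, 6, 0), (2, 2, 0), (2, 4, 1), (3, 6, 1), (4, 0, 1), (4, 5, 1), (5, 2, 0),
      (5, 7, 2), (7, 1, 1), (7, 5, 0), (8, 3, 2), (9, 0, 1), (9, 1, 1), (10, 6, 1)])
    (by decide +kernel) h.mul_self h.prod_cellWords (natGen_mem_facetGroup ρ)
    ((congrArg _ (image_natGen_lt_four ρ)).trans htop)

theorem finite_and_card_facetGroup_le_fiftySeven {ρ : Fin 4 → G} (h : CellRelations ρ 5 3 5) :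
    Finite (Subgroup.closure (ρ '' {j | j ≠ 3})) ∧
      Nat.card (Subgroup.closure (ρ '' {j | j ≠ 3})) ≤ 60 := by
  rw [← image_natGen_lt_three]
  exact CosetEnumeration.finite_and_card_closure_le (R := facetWords 5 3 5)
    (d :=
      [(0, 0), (0, 1), (0, 2), (1, 1), (1, 2), (2, 0), (2, 2), (3, 1), (4, 0), (4, 2), (5, 1),
      (6, 1), (6, 2), (7, 1), (8, 0), (9, 1), (9, 2), (10, 1), (11, 0), (12, 0), (12, 2),
      (13, 1), (14, 0), (15, 1), (16, 0), (16, 2), (17, 1), (18, 0), (19, 1), (20, 2),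
      (21, 1), (22, 0), (23, 1), (24, 0), (24, 2), (25, 2), (26, 1), (27, 0), (28, 1),
      (29, 0), (29, 2), (30, 1), (31, 0), (32, 1), (33, 0), (33, 2), (34, 2), (36, 1),
      (37, 0), (38, 1), (39, 0), (39, 2), (40, 2), (42, 0), (43, 1), (44, 0), (44, 2),
      (45, 2), (47, 1)])
    (c :=
      [(3, 2, 0), (7, 2, 0), (8, 1, 1), (10, 2, 0), (11, 1, 1), (15, 2, 1), (19, 2, 1),
      (20, 0, 1), (21, 2, 0), (22, 1, 1), (26, 2, 0), (27, 1, 1), (32, 2, 1), (34, 0, 1),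
      (35, 1, 0), (35, 2, 0), (38, 2, 1), (41, 1, 0), (41, 2, 0), (42, 1, 1), (45, 0, 1),
      (46, 2, 0), (48, 3, 0), (49, 0, 1), (50, 1, 1), (50, 2, 0), (51, 0, 1), (51, 1, 1),
      (52, 2, 0), (53, 0, 1), (54, 1, 1)])
    (by decide +kernel) h.mul_self h.prod_facetWords

theorem finite_and_index_facetGroup_le_fiftySeven {ρ : Fin 4 → G} (h : CellRelations ρ 5 3 5)
    (htop : Subgroup.closure (Set.range ρ) = ⊤) :
    Finite (G ⧸ Subgroup.closure (ρ '' {j | j ≠ 3})) ∧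
      Nat.card (G ⧸ Subgroup.closure (ρ '' {j | j ≠ 3})) ≤ 57 :=
  CosetEnumeration.finite_and_card_quotient_le (R := cellWords 5 3 5) (S := [0, 1, 2]) (m := 4)
    (d :=
      [(0, 3), (1, 2), (2, 1), (2, 3), (3, 0), (3, 3), (4, 2), (5, 1), (5, 3), (6, 2), (7, 1),
      (8, 0), (8, 3), (9, 2), (10, 1), (11, 0), (12, 3), (13, 2), (14, 1), (14, 3), (16, 1),
      (17, 2), (18, 1), (18, 3), (19, 0), (19, 3), (21, 0), (21, 2), (22, 1), (22, 3),
      (23, 0), (23, 3), (24, 2), (25, 1), (25, 3), (26, 2), (27, 2), (28, 3), (29, 0),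
      (29, 3), (30, 2), (31, 1), (31, 3), (32, 2), (33, 1), (34, 0), (36, 3), (37, 3),
      (39, 3), (41, 1), (42, 3), (43, 2), (44, 1), (45, 0), (50, 0), (52, 3)])
    (c :=
      [(1, 5, 0), (1, 6, 0), (2, 2, 0), (3, 1, 1), (4, 5, 0), (4, 6, 0), (5, 2, 1), (6, 5, 0),
      (7, 2, 0), (7, 4, 1), (8, 3, 2), (9, 6, 0), (10, 2, 0), (10, 7, 2), (11, 1, 1),
      (11, 4, 1), (12, 0, 1), (13, 5, 0), (15, 5, 0), (16, 2, 1), (16, 4, 1), (17, 0, 1),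
      (18, 2, 0), (19, 1, 1), (20, 6, 0), (21, 6, 1), (24, 5, 0), (24, 6, 0), (25, 2, 1),
      (26, 5, 0), (27, 0, 1), (27, 5, 1), (28, 1, 0), (28, 2, 0), (29, 1, 1), (30, 6, 0),
      (32, 5, 0), (33, 2, 0), (33, 4, 1), (34, 3, 2), (35, 0, 1), (35, 1, 1), (36, 2, 0),
      (37, 0, 1), (38, 5, 0), (38, 6, 0), (38, 7, 1), (39, 1, 1), (40, 5, 0), (43, 6, 0),
      (44, 2, 0), (44, 7, 2), (45, 1, 1), (45, 6, 1), (46, 6, 1), (47, 1, 1), (47, 5, 0),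
      (48, 0, 1), (48, 2, 1), (51, 2, 1), (53, 5, 0), (54, 2, 1), (54, 3, 1), (54, 4, 1),
      (55, 0, 1)])
    (by decide +kernel) h.mul_self h.prod_cellWords (natGen_mem_facetGroup ρ)
    ((congrArg _ (image_natGen_lt_four ρ)).trans htop)

theorem finite_and_index_facetGroup_le_simplex {ρ : Fin 4 → G} (h : CellRelations ρ 3 3 4)
    (htop : Subgroup.closure (Set.range ρ) = ⊤) :
    Finite (G ⧸ Subgroup.closure (ρ '' {j | j ≠ 3})) ∧
      Nat.card (G ⧸ Subgroup.closure (ρ '' {j | j ≠ 3})) ≤ 5 :=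
  CosetEnumeration.finite_and_card_quotient_le (R := cellWords 3 3 4) (S := [0, 1, 2]) (m := 4)
    (d :=
      [(0, 3), (1, 2), (2, 1), (3, 0)])
    (c :=
      [(1, 5, 0), (1, 6, 0), (2, 2, 0), (2, 4, 1), (3, 1, 1), (3, 6, 1), (4, 0, 1), (4, 2, 1),
      (4, 5, 1)])
    (by decide +kernel) h.mul_self h.prod_cellWords (natGen_mem_facetGroup ρ)
    ((congrArg _ (image_natGen_lt_four ρ)).trans htop)

theorem finite_and_index_facetGroup_le_cubic {ρ : Fin 4 → G} (h : CellRelations ρ 4 3 3)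
    (htop : Subgroup.closure (Set.range ρ) = ⊤) :
    Finite (G ⧸ Subgroup.closure (ρ '' {j | j ≠ 3})) ∧
      Nat.card (G ⧸ Subgroup.closure (ρ '' {j | j ≠ 3})) ≤ 4 :=
  CosetEnumeration.finite_and_card_quotient_le (R := cellWords 4 3 3) (S := [0, 1, 2]) (m := 4)
    (d :=
      [(0, 3), (1, 2), (2, 1)])
    (c :=
      [(1, 5, 0), (1, 6, 0), (2, 2, 0), (2, 7, 2), (3, 1, 1), (3, 3, 0)])
    (by decide +kernel) h.mul_self h.prod_cellWords (natGen_mem_facetGroup ρ)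
    ((congrArg _ (image_natGen_lt_four ρ)).trans htop)

end CellRelations

/-! ### Traces in `SL₂` and orders in `PSL₂` -/

section Trace

open Matrix

variable {F : Type*} [Field F]

/-- Writing `B` in the orthogonal basis `A`, `C`, `A * C` of the traceless matrices, this is the
theorem of Pythagoras; the form given here needs no division by two. -/
theorem trace_mul_mul_sq {R : Type*} [CommRing R] {A B C : Matrix (Fin 2) (Fin 2) R}
    (hA : A.trace = 0) (hB : B.trace = 0) (hC : C.trace = 0)
    (hA' : A.det = 1) (hB' : B.det = 1) (hC' : C.det = 1) (hAC : (A * C).trace = 0) :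
    (A * B).trace ^ 2 + (B * C).trace ^ 2 + (A * B * C).trace ^ 2 = 4 := by
  -- The square of the triple product is half the Gram determinant.
  have key : (A * B * C).trace ^ 2 = 4 * (A.det * B.det * C.det) - A.det * (B * C).trace ^ 2
      - B.det * (A * C).trace ^ 2 - C.det * (A * B).trace ^ 2
      - (A * B).trace * (B * C).trace * (A * C).trace := by
    simp only [trace_fin_two, det_fin_two, mul_apply, Fin.sum_univ_two] at hA hB hC ⊢
    rw [eq_neg_of_add_eq_zero_right hA, eq_neg_of_add_eq_zero_right hB,
      eq_neg_of_add_eq_zero_right hC]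
    ring
  rw [key, hA', hB', hC', hAC]
  ring

/-- Traceless matrices form a space of dimension three, so the Gram matrix of four of them with
respect to the trace form is singular. -/
theorem four_sub_mul_four_sub {R : Type*} [CommRing R] {A : Fin 4 → Matrix (Fin 2) (Fin 2) R}
    (htr : ∀ i, (A i).trace = 0) (hdet : ∀ i, (A i).det = 1) (h02 : (A 0 * A 2).trace = 0)
    (h03 : (A 0 * A 3).trace = 0) (h13 : (A 1 * A 3).trace = 0) :
    (4 - (A 0 * A 1).trace ^ 2) * (4 - (A 2 * A 3).trace ^ 2) = 4 * (A 1 * A 2).trace ^ 2 := by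
  -- The zero columns pad the coordinates of the four matrices, and those of their duals.
  let U : Matrix (Fin 4) (Fin 4) R := of fun i => ![A i 0 0, A i 0 1, A i 1 0, 0]
  let V : Matrix (Fin 4) (Fin 4) R := of fun i => ![2 * A i 0 0, A i 1 0, A i 0 1, 0]
  have hU : (U * Vᵀ).det = 0 := by
    rw [det_mul, det_eq_zero_of_column_eq_zero 3 fun i => rfl, zero_mul]
  have hdiag : ∀ i, A i 1 1 = -A i 0 0 := fun i =>
    eq_neg_of_add_eq_zero_right (by simpa only [trace_fin_two] using htr i)
  have hent : ∀ i j, (U * Vᵀ) i j = (A i * A j).trace := fun i j => by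
    simp [U, V, mul_apply, trace_fin_two, Fin.sum_univ_succ, hdiag]
    ring
  have hself : ∀ i, (A i * A i).trace = -2 := fun i => by
    have := hdet i
    rw [det_fin_two, hdiag] at this
    simp only [trace_fin_two, mul_apply, Fin.sum_univ_two, hdiag]
    linear_combination (-2) * this
  have hG : U * Vᵀ = !![-2, (A 0 * A 1).trace, 0, 0;
      (A 0 * A 1).trace, -2, (A 1 * A 2).trace, 0;
      0, (A 1 * A 2).trace, -2, (A 2 * A 3).trace;
      0, 0, (A 2 * A 3).trace, -2] := by
    ext i j
    rw [hent]
    fin_cases i <;> fin_cases j <;>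
      simp [hself, h02, h03, h13, trace_mul_comm (A 1) (A 0), trace_mul_comm (A 2) (A 0),
        trace_mul_comm (A 3) (A 0), trace_mul_comm (A 2) (A 1), trace_mul_comm (A 3) (A 1),
        trace_mul_comm (A 3) (A 2)]
  rw [hG, det_succ_row_zero] at hU
  simp [Fin.sum_univ_succ, det_fin_three, Fin.succAbove] at hU
  linear_combination hU

/-- The projection of `SL₂` onto `PSL₂`. -/
abbrev toPSL : Matrix.SpecialLinearGroup (Fin 2) F →*
    Matrix.ProjectiveSpecialLinearGroup (Fin 2) F :=
  QuotientGroup.mk' _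

theorem toPSL_eq_one_iff {A : Matrix.SpecialLinearGroup (Fin 2) F} :
    toPSL A = 1 ↔ ∃ r : F, (A : Matrix (Fin 2) (Fin 2) F) = r • 1 := by
  rw [← MonoidHom.mem_ker, QuotientGroup.ker_mk', Matrix.SpecialLinearGroup.mem_center_iff]
  constructor
  · rintro ⟨r, -, hr⟩
    exact ⟨r, by rw [← hr, scalar_apply, smul_one_eq_diagonal]⟩
  · rintro ⟨r, hr⟩
    refine ⟨r, ?_, by rw [hr, scalar_apply, smul_one_eq_diagonal]⟩
    have := A.det_coe
    rwa [hr, det_smul, det_one, mul_one] at this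

/-- By Cayley–Hamilton each power of `A` is a combination `u • A + v • 1`, which is scalar
exactly if `u = 0`. -/
theorem toPSL_pow_eq_one_iff {A : Matrix.SpecialLinearGroup (Fin 2) F} (hA : toPSL A ≠ 1) {n : ℕ}
    {u v : F}
    (h : (A : Matrix (Fin 2) (Fin 2) F) ^ n = u • (A : Matrix (Fin 2) (Fin 2) F) + v • 1) :
    toPSL A ^ n = 1 ↔ u = 0 := by
  rw [← map_pow, toPSL_eq_one_iff, Matrix.SpecialLinearGroup.coe_pow, h]
  constructor
  · rintro ⟨r, hr⟩
    by_contra hu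
    refine hA (toPSL_eq_one_iff.mpr ⟨u⁻¹ * (r - v), ?_⟩)
    rw [mul_smul, sub_smul, ← hr, add_sub_cancel_right, inv_smul_smul₀ hu]
  · rintro rfl
    exact ⟨v, by rw [zero_smul, zero_add]⟩

theorem sq_eq_trace_smul_sub (A : Matrix.SpecialLinearGroup (Fin 2) F) :
    (A : Matrix (Fin 2) (Fin 2) F) ^ 2 =
      (A : Matrix (Fin 2) (Fin 2) F).trace • (A : Matrix (Fin 2) (Fin 2) F) + (-1 : F) • 1 := by
  have hdet := A.det_coe
  rw [det_fin_two] at hdet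
  ext i j
  fin_cases i <;> fin_cases j <;>
    simp [sq, mul_apply, trace_fin_two, Fin.sum_univ_two] <;>
    grind

theorem pow_succ_eq {A : Matrix.SpecialLinearGroup (Fin 2) F} {n : ℕ} {u v : F}
    (h : (A : Matrix (Fin 2) (Fin 2) F) ^ n = u • (A : Matrix (Fin 2) (Fin 2) F) + v • 1) :
    (A : Matrix (Fin 2) (Fin 2) F) ^ (n + 1) =
      (u * (A : Matrix (Fin 2) (Fin 2) F).trace + v) • (A : Matrix (Fin 2) (Fin 2) F)
        + (-u) • 1 := by
  rw [pow_succ, h, add_mul, smul_mul_assoc, ← sq, sq_eq_trace_smul_sub, smul_mul_assoc, one_mul]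
  module

theorem toPSL_sq_eq_one_iff {A : Matrix.SpecialLinearGroup (Fin 2) F} (hA : toPSL A ≠ 1) :
    toPSL A ^ 2 = 1 ↔ (A : Matrix (Fin 2) (Fin 2) F).trace = 0 :=
  toPSL_pow_eq_one_iff hA (sq_eq_trace_smul_sub A)

theorem toPSL_pow_three_eq_one_iff {A : Matrix.SpecialLinearGroup (Fin 2) F} (hA : toPSL A ≠ 1) :
    toPSL A ^ 3 = 1 ↔ (A : Matrix (Fin 2) (Fin 2) F).trace ^ 2 = 1 := by
  rw [toPSL_pow_eq_one_iff hA (pow_succ_eq (sq_eq_trace_smul_sub A)),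
    ← sub_eq_zero (b := (1 : F))]
  ring_nf

theorem toPSL_pow_four_eq_one_iff {A : Matrix.SpecialLinearGroup (Fin 2) F}
    (hA : toPSL A ^ 2 ≠ 1) :
    toPSL A ^ 4 = 1 ↔ (A : Matrix (Fin 2) (Fin 2) F).trace ^ 2 = 2 := by
  have h1 : toPSL A ≠ 1 := fun h => hA (by rw [h, one_pow])
  rw [Ne, toPSL_sq_eq_one_iff h1] at hA
  rw [toPSL_pow_eq_one_iff h1 (pow_succ_eq (pow_succ_eq (sq_eq_trace_smul_sub A))),
    ← sub_eq_zero (b := (2 : F)), ← mul_right_inj' hA (b := _ - 2), mul_zero]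
  ring_nf

theorem toPSL_pow_five_eq_one_iff {A : Matrix.SpecialLinearGroup (Fin 2) F} (hA : toPSL A ≠ 1) :
    toPSL A ^ 5 = 1 ↔ ((A : Matrix (Fin 2) (Fin 2) F).trace ^ 2) ^ 2
      - 3 * (A : Matrix (Fin 2) (Fin 2) F).trace ^ 2 + 1 = 0 := by
  rw [toPSL_pow_eq_one_iff hA (pow_succ_eq (pow_succ_eq (pow_succ_eq (sq_eq_trace_smul_sub A))))]
  ring_nf

end Trace

/-! ### The order of `PSL₂` -/

section Card

variable (F : Type*) [Field F]

theorem card_specialLinearGroup_two [Finite F] :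
    Nat.card (Matrix.SpecialLinearGroup (Fin 2) F) = Nat.card F * (Nat.card F ^ 2 - 1) := by
  classical
  have := Fintype.ofFinite F
  have hbij : Function.Bijective (fun A : Matrix.SpecialLinearGroup (Fin 2) F =>
      (⟨Matrix.SpecialLinearGroup.toGL A, by
        rw [MonoidHom.mem_ker]
        ext
        simp⟩ : (Matrix.GeneralLinearGroup.det (n := Fin 2) (R := F)).ker)) := by
    constructor
    · intro A B hAB
      exact Matrix.SpecialLinearGroup.toGL_injective (congrArg Subtype.val hAB)
    · rintro ⟨g, hg⟩
      refine ⟨⟨g, ?_⟩, ?_⟩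
      · exact congrArg Units.val (MonoidHom.mem_ker.mp hg)
      · ext : 2
        rfl
  have hGL := Subgroup.card_eq_card_quotient_mul_card_subgroup
    (Matrix.GeneralLinearGroup.det (n := Fin 2) (R := F)).ker
  rw [← Nat.card_congr (Equiv.ofBijective _ hbij), Matrix.card_GL_field, Nat.card_congr
    (QuotientGroup.quotientKerEquivOfSurjective _
      Matrix.GeneralLinearGroup.det_surjective).toEquiv,
    Nat.card_eq_fintype_card, Fintype.card_units, Fin.prod_univ_two] at hGL
  have hq : 1 < Fintype.card F := Fintype.one_lt_card
  rw [Nat.card_eq_fintype_card (α := F)]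
  refine Nat.eq_of_mul_eq_mul_left (Nat.sub_pos_of_lt hq) (hGL.symm.trans ?_)
  obtain ⟨k, hk⟩ := Nat.exists_eq_add_of_lt hq
  simp only [Fin.val_zero, Fin.val_one, pow_zero, pow_one]
  have : Fintype.card F ^ 2 - Fintype.card F = (Fintype.card F - 1) * Fintype.card F := by
    rw [Nat.sub_mul, one_mul, sq]
  rw [this]
  ring

theorem card_center_specialLinearGroup_two_le :
    Nat.card (Subgroup.center (Matrix.SpecialLinearGroup (Fin 2) F)) ≤ 2 := by
  rw [Nat.card_congr (Matrix.SpecialLinearGroup.center_equiv_rootsOfUnity' 0).toEquiv]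
  exact card_rootsOfUnity F 2

theorem le_two_mul_card_projectiveSpecialLinearGroup_two [Finite F] :
    Nat.card F * (Nat.card F ^ 2 - 1) ≤
      2 * Nat.card (Matrix.ProjectiveSpecialLinearGroup (Fin 2) F) := by
  rw [← card_specialLinearGroup_two, mul_comm 2, Subgroup.card_eq_card_quotient_mul_card_subgroup
    (Subgroup.center (Matrix.SpecialLinearGroup (Fin 2) F))]
  exact Nat.mul_le_mul_left _ (card_center_specialLinearGroup_two_le F)

end Card

/-! ### Element orders in `S₄` and `A₅` -/

section Groups

theorem perm_four_pow_eq_one (g : Equiv.Perm (Fin 4)) : g ^ 2 = 1 ∨ g ^ 3 = 1 ∨ g ^ 4 = 1 := by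
  revert g
  decide +kernel

theorem alternatingGroup_five_pow_eq_one (g : alternatingGroup (Fin 5)) :
    g ^ 2 = 1 ∨ g ^ 3 = 1 ∨ g ^ 5 = 1 := by
  have h : ∀ g : Equiv.Perm (Fin 5), Equiv.Perm.sign g = 1 → g ^ 2 = 1 ∨ g ^ 3 = 1 ∨ g ^ 5 = 1 := by
    decide +kernel
  have := h g g.2
  simpa only [← Subgroup.coe_pow, OneMemClass.coe_eq_one] using this

theorem perm_four_center_eq_bot : Subgroup.center (Equiv.Perm (Fin 4)) = ⊥ := by
  rw [eq_bot_iff]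
  intro g hg
  rw [Subgroup.mem_center_iff] at hg
  rw [Subgroup.mem_bot]
  revert g
  decide

theorem alternatingGroup_five_center_eq_bot : Subgroup.center (alternatingGroup (Fin 5)) = ⊥ :=
  alternatingGroup.center_eq_bot (by simp)

variable {G : Type*} [Group G]

theorem eq_one_of_mulEquiv_of_commute {H : Subgroup G} {K : Type*} [Group K] (e : H ≃* K)
    (hK : Subgroup.center K = ⊥) {z : G} (hz : z ∈ H) (hcomm : ∀ h ∈ H, Commute h z) : z = 1 := by
  have hmem : e ⟨z, hz⟩ ∈ Subgroup.center K := by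
    rw [Subgroup.mem_center_iff]
    intro k
    obtain ⟨h, rfl⟩ := e.surjective k
    rw [← map_mul, ← map_mul]
    exact congrArg e (Subtype.ext (hcomm h h.2).eq)
  rw [hK, Subgroup.mem_bot, EmbeddingLike.map_eq_one_iff] at hmem
  exact congrArg Subtype.val hmem

theorem commute_of_sq_eq_one {a b : G} (ha : a ^ 2 = 1) (hb : b ^ 2 = 1) (h : (a * b) ^ 2 = 1) :
    Commute a b := by
  rw [sq] at ha hb h
  have e := mul_eq_one_iff_eq_inv.mp h
  rw [mul_inv_rev, ← mul_eq_one_iff_eq_inv.mp ha, ← mul_eq_one_iff_eq_inv.mp hb] at e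
  exact e

theorem commute_of_mem_closure_triple {a b c h z : G} (hh : h ∈ Subgroup.closure {a, b, c})
    (ha : Commute a z) (hb : Commute b z) (hc : Commute c z) : Commute h z := by
  have hle : Subgroup.closure {a, b, c} ≤ Subgroup.centralizer {z} := by
    rw [Subgroup.closure_le]
    rintro x (rfl | rfl | rfl) <;> rw [SetLike.mem_coe, Subgroup.mem_centralizer_singleton_iff]
    exacts [ha.eq, hb.eq, hc.eq]
  exact Subgroup.mem_centralizer_singleton_iff.mp (hle hh)

/-- Three involutions `a`, `b`, `c` such that `a` and `c` commute and no nontrivial element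
of the group that they generate is central. -/
structure CenterlessTriple (a b c : G) : Prop where
  sq_left : a ^ 2 = 1
  sq_mid : b ^ 2 = 1
  sq_right : c ^ 2 = 1
  left_ne_one : a ≠ 1
  right_ne_one : c ≠ 1
  ne : a ≠ c
  commute : Commute a c
  eq_one : ∀ z ∈ Subgroup.closure {a, b, c}, Commute a z → Commute b z → Commute c z → z = 1

namespace CenterlessTriple

variable {a b c : G}

theorem sq_left_mid_ne_one (h : CenterlessTriple a b c) : (a * b) ^ 2 ≠ 1 := fun hab =>
  h.left_ne_one <| h.eq_one a (Subgroup.subset_closure (by simp)) (Commute.refl a)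
    (commute_of_sq_eq_one h.sq_left h.sq_mid hab).symm h.commute.symm

theorem sq_mid_right_ne_one (h : CenterlessTriple a b c) : (b * c) ^ 2 ≠ 1 := fun hbc =>
  h.right_ne_one <| h.eq_one c (Subgroup.subset_closure (by simp)) h.commute
    (commute_of_sq_eq_one h.sq_mid h.sq_right hbc) (Commute.refl c)

theorem sq_petrie_ne_one (h : CenterlessTriple a b c) : (a * b * c) ^ 2 ≠ 1 := by
  intro habc
  have hc := h.sq_right
  -- `a * c` would be central: it is an involution, and its product with `b` is conjugate to
  -- `a * b * c`.
  have hac : (a * c) ^ 2 = 1 := by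
    rw [h.commute.mul_pow, h.sq_left, h.sq_right, one_mul]
  have hb : (a * c * b) ^ 2 = 1 := by
    have : a * c * b = c * (a * b * c) * c⁻¹ := by
      rw [h.commute.eq]
      group
    rw [this, conj_pow, habc, mul_one, mul_inv_cancel]
  have hz : a * c = 1 := h.eq_one (a * c)
    (mul_mem (Subgroup.subset_closure (by simp)) (Subgroup.subset_closure (by simp)))
    ((Commute.refl a).mul_right h.commute)
    (commute_of_sq_eq_one hac h.sq_mid hb).symm
    (h.commute.symm.mul_right (Commute.refl c))
  apply h.ne
  rw [sq] at hc
  exact (mul_eq_one_iff_eq_inv.mp hz).trans (mul_eq_one_iff_eq_inv.mp hc).symm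

end CenterlessTriple

end Groups

/-! ### Solving the equations for the squared traces -/

section Algebra

variable {F : Type*} [Field F] {X Y Z W V : F}

/-- In characteristic two the singular Gram matrix would force two generators that are adjacent in
the string to commute. -/
theorem two_ne_zero_of_gram (hX : X ≠ 0) (hZ : Z ≠ 0) (h : (4 - X) * (4 - Z) = 4 * Y) :
    (2 : F) ≠ 0 := by
  intro h2
  apply mul_ne_zero hX hZ
  linear_combination h + (-8 + 2 * X + 2 * Z + 2 * Y) * h2

/-- The Schläfli types `{3, 3, 3}` and `{4, 3, 4}`. The first one forces characteristic five, but
only that `2` is a square is needed below. -/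
theorem octahedral_octahedral (h2 : (2 : F) ≠ 0) (hX : X = 1 ∨ X = 2) (hY : Y = 1 ∨ Y = 2)
    (hW : W = 1 ∨ W = 2) (hZ : Z = 1 ∨ Z = 2) (hV : V = 1 ∨ V = 2) (h : (4 - X) * (4 - Z) = 4 * Y)
    (h1 : X + Y + W = 4) (h3 : Y + Z + V = 4) :
    (X = 1 ∧ Y = 1 ∧ Z = 1 ∧ W = 2 ∧ V = 2) ∨ (X = 2 ∧ Y = 1 ∧ Z = 2 ∧ W = 1 ∧ V = 1) := by
  grind

theorem not_octahedral_icosahedral (h2 : (2 : F) ≠ 0) (hX : X = 1 ∨ X = 2) (hY : Y = 1 ∨ Y = 2)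
    (hY' : Y = 1 ∨ Y ^ 2 - 3 * Y + 1 = 0) (hZ : Z = 1 ∨ Z ^ 2 - 3 * Z + 1 = 0)
    (hV : V = 1 ∨ V ^ 2 - 3 * V + 1 = 0) (h : (4 - X) * (4 - Z) = 4 * Y)
    (h3 : Y + Z + V = 4) : False := by
  grind

/-- The Schläfli types `{3, 5, 3}` and `{5, 3, 5}`; the roots of `t ^ 2 - 3 * t + 1` come in pairs
`t`, `3 - t`. -/
theorem icosahedral_icosahedral (h2 : (2 : F) ≠ 0) (hX : X = 1 ∨ X ^ 2 - 3 * X + 1 = 0)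
    (hY : Y = 1 ∨ Y ^ 2 - 3 * Y + 1 = 0) (hW : W = 1 ∨ W ^ 2 - 3 * W + 1 = 0)
    (hZ : Z = 1 ∨ Z ^ 2 - 3 * Z + 1 = 0) (hV : V = 1 ∨ V ^ 2 - 3 * V + 1 = 0)
    (h : (4 - X) * (4 - Z) = 4 * Y) (h1 : X + Y + W = 4) (h3 : Y + Z + V = 4) :
    (X = 1 ∧ Y ^ 2 - 3 * Y + 1 = 0 ∧ Z = 1 ∧ W ^ 2 - 3 * W + 1 = 0 ∧ V ^ 2 - 3 * V + 1 = 0 ∧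
      (11 : F) = 0) ∨
    (X ^ 2 - 3 * X + 1 = 0 ∧ Y = 1 ∧ Z ^ 2 - 3 * Z + 1 = 0 ∧ W ^ 2 - 3 * W + 1 = 0 ∧
      V ^ 2 - 3 * V + 1 = 0 ∧ (19 : F) = 0) := by
  have hne : ∀ f : F, f ^ 2 - 3 * f + 1 = 0 → f ≠ 1 := by
    rintro _ hf rfl
    exact one_ne_zero (α := F) (by linear_combination -hf)
  have hconj : ∀ f g : F, f ^ 2 - 3 * f + 1 = 0 → g ^ 2 - 3 * g + 1 = 0 → g = f ∨ g = 3 - f := by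
    intro f g hf hg
    have : (g - f) * (g - (3 - f)) = 0 := by linear_combination hg - hf
    exact (mul_eq_zero.mp this).imp sub_eq_zero.mp sub_eq_zero.mp
  obtain rfl : W = 4 - X - Y := by linear_combination h1
  obtain rfl : V = 4 - Y - Z := by linear_combination h3
  rcases hX with rfl | hX <;> rcases hY with rfl | hY
  · grind
  · rcases hZ with rfl | hZ
    · grind
    · rcases hconj _ _ hY hZ with rfl | rfl
      · grind
      · grind
  · rcases hZ with rfl | hZ
    · grind
    · rcases hconj _ _ hX hZ with rfl | rfl
      · grind
      · grind
  · rcases hconj _ _ hX hY with rfl | rfl <;> rcases hZ with rfl | hZ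
    · grind
    · rcases hconj _ _ hX hZ with rfl | rfl <;> grind
    · grind
    · rcases hconj _ _ hX hZ with rfl | rfl <;> grind

theorem seven_le_card_of_sq_eq_two [Finite F] (h2 : (2 : F) ≠ 0) {w : F} (hw : w ^ 2 = 2) :
    7 ≤ Nat.card F := by
  have := Fintype.ofFinite F
  have hq := FiniteField.pow_card w
  have hc : (Nat.card F : F) = 0 := by simp
  have h1 : 1 < Nat.card F := Finite.one_lt_card
  rw [← Nat.card_eq_fintype_card] at hq
  generalize Nat.card F = n at *
  by_contra! hn
  -- For each `n < 7` the equations `n = 0`, `w ^ n = w` and `w ^ 2 = 2` give `2 = 0`.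
  interval_cases n <;> grind

end Algebra

/-! ### Squared traces and element orders -/

section SqTrace

variable {F : Type*} [Field F]

/-- The square of the trace; it depends only on the image in `PSL₂`. -/
def sqTrace (A : Matrix.SpecialLinearGroup (Fin 2) F) : F :=
  (A : Matrix (Fin 2) (Fin 2) F).trace ^ 2

variable {G : Type*} [Group G] (φ : G ≃* Matrix.ProjectiveSpecialLinearGroup (Fin 2) F)

theorem toPSL_pow_eq_one_iff_of_eq {g : G} {A : Matrix.SpecialLinearGroup (Fin 2) F}
    (hA : toPSL A = φ g) (n : ℕ) : toPSL A ^ n = 1 ↔ g ^ n = 1 := by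
  rw [hA, ← map_pow, EmbeddingLike.map_eq_one_iff]

theorem toPSL_ne_one_of_eq {g : G} {A : Matrix.SpecialLinearGroup (Fin 2) F}
    (hA : toPSL A = φ g) (hg : g ≠ 1) : toPSL A ≠ 1 := by
  rwa [hA, Ne, EmbeddingLike.map_eq_one_iff]

theorem trace_eq_zero_of_sq_eq_one {g : G} {A : Matrix.SpecialLinearGroup (Fin 2) F}
    (hA : toPSL A = φ g) (hg : g ≠ 1) (hg2 : g ^ 2 = 1) :
    (A : Matrix (Fin 2) (Fin 2) F).trace = 0 :=
  (toPSL_sq_eq_one_iff (toPSL_ne_one_of_eq φ hA hg)).mp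
    ((toPSL_pow_eq_one_iff_of_eq φ hA 2).mpr hg2)

/-- The values of the squared trace on elements of small order. -/
theorem sqTrace_of_sq_ne_one {g : G} {A : Matrix.SpecialLinearGroup (Fin 2) F}
    (hA : toPSL A = φ g) (hg : g ^ 2 ≠ 1) :
    sqTrace A ≠ 0 ∧ (g ^ 3 = 1 ↔ sqTrace A = 1) ∧ (g ^ 4 = 1 ↔ sqTrace A = 2) ∧
      (g ^ 5 = 1 ↔ sqTrace A ^ 2 - 3 * sqTrace A + 1 = 0) := by
  have h2 : toPSL A ^ 2 ≠ 1 := fun h => hg ((toPSL_pow_eq_one_iff_of_eq φ hA 2).mp h)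
  have h1 : toPSL A ≠ 1 := fun h => h2 (by rw [h, one_pow])
  refine ⟨pow_ne_zero 2 fun h => h2 ((toPSL_sq_eq_one_iff h1).mpr h), ?_, ?_, ?_⟩
  · rw [← toPSL_pow_eq_one_iff_of_eq φ hA, toPSL_pow_three_eq_one_iff h1, sqTrace]
  · rw [← toPSL_pow_eq_one_iff_of_eq φ hA, toPSL_pow_four_eq_one_iff h2, sqTrace]
  · rw [← toPSL_pow_eq_one_iff_of_eq φ hA, toPSL_pow_five_eq_one_iff h1, sqTrace]

theorem sqTrace_eq_one_or_two {H : Subgroup G} (e : H ≃* Equiv.Perm (Fin 4)) {g : G}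
    (hgH : g ∈ H) {A : Matrix.SpecialLinearGroup (Fin 2) F} (hA : toPSL A = φ g)
    (hg : g ^ 2 ≠ 1) : sqTrace A = 1 ∨ sqTrace A = 2 := by
  obtain ⟨-, h3, h4, -⟩ := sqTrace_of_sq_ne_one φ hA hg
  have key : ∀ n, e ⟨g, hgH⟩ ^ n = 1 ↔ g ^ n = 1 := fun n => by
    rw [← map_pow, EmbeddingLike.map_eq_one_iff, Subtype.ext_iff]
    rfl
  have := perm_four_pow_eq_one (e ⟨g, hgH⟩)
  rw [key, key, key, h3, h4] at this
  exact this.resolve_left hg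

theorem sqTrace_eq_one_or_root {H : Subgroup G} (e : H ≃* alternatingGroup (Fin 5)) {g : G}
    (hgH : g ∈ H) {A : Matrix.SpecialLinearGroup (Fin 2) F} (hA : toPSL A = φ g)
    (hg : g ^ 2 ≠ 1) : sqTrace A = 1 ∨ sqTrace A ^ 2 - 3 * sqTrace A + 1 = 0 := by
  obtain ⟨-, h3, -, h5⟩ := sqTrace_of_sq_ne_one φ hA hg
  have key : ∀ n, e ⟨g, hgH⟩ ^ n = 1 ↔ g ^ n = 1 := fun n => by
    rw [← map_pow, EmbeddingLike.map_eq_one_iff, Subtype.ext_iff]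
    rfl
  have := alternatingGroup_five_pow_eq_one (e ⟨g, hgH⟩)
  rw [key, key, key, h3, h5] at this
  exact this.resolve_left hg

end SqTrace

/-! ### String representations of `PSL₂` -/

section Maniplex

namespace ReflexibleManiplex

variable (M : ReflexibleManiplex.{u} 4)

theorem ρ_sq (i : Fin 4) : M.ρ i ^ 2 = 1 := by
  rw [← M.isStringRepresentation.orderOf_eq_two i, pow_orderOf_eq_one]

theorem ρ_ne_one (i : Fin 4) : M.ρ i ≠ 1 := fun h => by
  have := M.isStringRepresentation.orderOf_eq_two i
  rw [h, orderOf_one] at this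
  omega

theorem commute_ρ {i j : Fin 4} (h : (i : ℕ) + 1 < j) : Commute (M.ρ i) (M.ρ j) :=
  M.isStringRepresentation.commute i j h

theorem mul_sq_eq_one {i j : Fin 4} (h : (i : ℕ) + 1 < j) : (M.ρ i * M.ρ j) ^ 2 = 1 := by
  rw [(M.commute_ρ h).mul_pow, M.ρ_sq, M.ρ_sq, one_mul]

theorem mul_ne_one {i j : Fin 4} (h : i ≠ j) : M.ρ i * M.ρ j ≠ 1 := fun e => by
  apply h
  apply M.isStringRepresentation.injective
  have hj := M.ρ_sq j
  rw [sq] at hj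
  exact (mul_eq_one_iff_eq_inv.mp e).trans (mul_eq_one_iff_eq_inv.mp hj).symm

theorem faceGroup_three : M.faceGroup 3 = Subgroup.closure {M.ρ 0, M.ρ 1, M.ρ 2} := by
  rw [faceGroup, show {j : Fin 4 | j ≠ 3} = {0, 1, 2} by ext j; fin_cases j <;> simp]
  simp [Set.image_insert_eq]

theorem faceGroup_zero : M.faceGroup 0 = Subgroup.closure {M.ρ 1, M.ρ 2, M.ρ 3} := by
  rw [faceGroup, show {j : Fin 4 | j ≠ 0} = {1, 2, 3} by ext j; fin_cases j <;> simp]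
  simp [Set.image_insert_eq]

theorem centerlessTriple_facet {K : Type*} [Group K] (e : M.faceGroup 3 ≃* K)
    (hK : Subgroup.center K = ⊥) : CenterlessTriple (M.ρ 0) (M.ρ 1) (M.ρ 2) where
  sq_left := M.ρ_sq 0
  sq_mid := M.ρ_sq 1
  sq_right := M.ρ_sq 2
  left_ne_one := M.ρ_ne_one 0
  right_ne_one := M.ρ_ne_one 2
  ne := M.isStringRepresentation.injective.ne (by decide)
  commute := M.commute_ρ (by decide)
  eq_one z hz h0 h1 h2 := by
    rw [← faceGroup_three] at hz
    refine eq_one_of_mulEquiv_of_commute e hK hz fun h hh => ?_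
    rw [faceGroup_three] at hh
    exact commute_of_mem_closure_triple hh h0 h1 h2

theorem centerlessTriple_vertex {K : Type*} [Group K] (e : M.faceGroup 0 ≃* K)
    (hK : Subgroup.center K = ⊥) : CenterlessTriple (M.ρ 1) (M.ρ 2) (M.ρ 3) where
  sq_left := M.ρ_sq 1
  sq_mid := M.ρ_sq 2
  sq_right := M.ρ_sq 3
  left_ne_one := M.ρ_ne_one 1
  right_ne_one := M.ρ_ne_one 3
  ne := M.isStringRepresentation.injective.ne (by decide)
  commute := M.commute_ρ (by decide)
  eq_one z hz h0 h1 h2 := by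
    rw [← faceGroup_zero] at hz
    refine eq_one_of_mulEquiv_of_commute e hK hz fun h hh => ?_
    rw [faceGroup_zero] at hh
    exact commute_of_mem_closure_triple hh h0 h1 h2

theorem cellRelations {k l a : ℕ} (h01 : (M.ρ 0 * M.ρ 1) ^ k = 1) (h12 : (M.ρ 1 * M.ρ 2) ^ l = 1)
    (h23 : (M.ρ 2 * M.ρ 3) ^ k = 1) (h012 : (M.ρ 0 * M.ρ 1 * M.ρ 2) ^ a = 1)
    (h123 : (M.ρ 1 * M.ρ 2 * M.ρ 3) ^ a = 1) : CellRelations M.ρ k l a where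
  sq := M.ρ_sq
  pow01 := h01
  pow12 := h12
  pow23 := h23
  pow02 := M.mul_sq_eq_one (by decide)
  pow03 := M.mul_sq_eq_one (by decide)
  pow13 := M.mul_sq_eq_one (by decide)
  pow012 := h012
  pow123 := h123

theorem card_aut : Nat.card M.Aut = Nat.card (M.Aut ⧸ M.faceGroup 3) * Nat.card (M.faceGroup 3) :=
  Subgroup.card_eq_card_quotient_mul_card_subgroup _

/-- A quotient of a universal polytope whose group is at least as large is isomorphic to it. -/
theorem isIsomorphic_of_card_le {k l : ℕ} (N : ReflexibleManiplex.{v} 4)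
    (e : PresentedGroup (cellRels k l) ≃* N.Aut) (he : ∀ i, e (PresentedGroup.of i) = N.ρ i)
    (hM : CellRelations M.ρ k l 5) [Finite N.Aut] (hcard : Nat.card N.Aut ≤ Nat.card M.Aut) :
    M.IsIsomorphic N := by
  have hrel : ∀ r ∈ cellRels k l, FreeGroup.lift M.ρ r = 1 := by
    intro r hr
    simp only [cellRels, Set.mem_insert_iff, Set.mem_singleton_iff] at hr
    rcases hr with h | h | h | h | h | h | h | h | h | h | h | h <;> rw [h] <;>
      simp only [cellGen, map_mul, map_pow, FreeGroup.lift_apply_of]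
    exacts [hM.sq 0, hM.sq 1, hM.sq 2, hM.sq 3, hM.pow01, hM.pow12, hM.pow23, hM.pow02, hM.pow03,
      hM.pow13, hM.pow012, hM.pow123]
  let f : N.Aut →* M.Aut := (PresentedGroup.toGroup hrel).comp e.symm.toMonoidHom
  have hf : ∀ i, f (N.ρ i) = M.ρ i := fun i => by
    simp [f, ← he]
  have hsurj : Function.Surjective f := by
    rw [← MonoidHom.range_eq_top, eq_top_iff, ← M.isStringRepresentation.closure_eq_top,
      Subgroup.closure_le]
    rintro _ ⟨i, rfl⟩
    exact ⟨N.ρ i, hf i⟩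
  have := Finite.of_surjective f hsurj
  have hbij : Function.Bijective f := hsurj.bijective_of_nat_card_le hcard
  exact ⟨(MulEquiv.ofBijective f hbij).symm, fun i => by
    rw [MulEquiv.symm_apply_eq]
    exact (hf i).symm⟩

end ReflexibleManiplex

theorem card_le_of_card_facet_le (M : ReflexibleManiplex.{u} 4) {m n : ℕ}
    (h : Finite (M.Aut ⧸ M.faceGroup 3) ∧ Nat.card (M.Aut ⧸ M.faceGroup 3) ≤ m)
    (h' : Finite (M.faceGroup 3) ∧ Nat.card (M.faceGroup 3) ≤ n) :
    Finite M.Aut ∧ Nat.card M.Aut ≤ m * n := by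
  have := h.1
  have := h'.1
  refine ⟨Nat.finite_of_card_ne_zero ?_, M.card_aut ▸ Nat.mul_le_mul h.2 h'.2⟩
  rw [M.card_aut]
  exact mul_ne_zero Nat.card_pos.ne' Nat.card_pos.ne'

theorem cellRelations_of {k l : ℕ} (N : ReflexibleManiplex.{v} 4)
    (e : PresentedGroup (cellRels k l) ≃* N.Aut) (he : ∀ i, e (PresentedGroup.of i) = N.ρ i) :
    CellRelations N.ρ k l 5 := by
  have hgen : ∀ i, e (PresentedGroup.mk (cellRels k l) (cellGen i)) = N.ρ i := he
  have hone : ∀ (w : FreeGroup (Fin 4)) (n : ℕ), w ^ n ∈ cellRels k l →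
      e (PresentedGroup.mk (cellRels k l) w) ^ n = 1 := fun w n hw => by
    rw [← map_pow, ← map_pow, PresentedGroup.one_of_mem hw, map_one]
  apply N.cellRelations
  · simpa only [map_mul, hgen] using hone (cellGen 0 * cellGen 1) k (by simp [cellRels])
  · simpa only [map_mul, hgen] using hone (cellGen 1 * cellGen 2) l (by simp [cellRels])
  · simpa only [map_mul, hgen] using hone (cellGen 2 * cellGen 3) k (by simp [cellRels])
  · simpa only [map_mul, hgen] using
      hone (cellGen 0 * cellGen 1 * cellGen 2) 5 (by simp [cellRels])
  · simpa only [map_mul, hgen] using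
      hone (cellGen 1 * cellGen 2 * cellGen 3) 5 (by simp [cellRels])

theorem cellRelations_elevenCell : CellRelations elevenCell.ρ 3 5 5 :=
  cellRelations_of elevenCell (MulEquiv.refl _) fun _ => rfl

theorem cellRelations_fiftySevenCell : CellRelations fiftySevenCell.ρ 5 3 5 :=
  cellRelations_of fiftySevenCell (MulEquiv.refl _) fun _ => rfl

theorem card_elevenCell_le : Finite elevenCell.Aut ∧ Nat.card elevenCell.Aut ≤ 11 * 60 :=
  card_le_of_card_facet_le elevenCell
    (finite_and_index_facetGroup_le_eleven cellRelations_elevenCell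
      elevenCell.isStringRepresentation.closure_eq_top)
    (finite_and_card_facetGroup_le_eleven cellRelations_elevenCell)

theorem card_fiftySevenCell_le :
    Finite fiftySevenCell.Aut ∧ Nat.card fiftySevenCell.Aut ≤ 57 * 60 :=
  card_le_of_card_facet_le fiftySevenCell
    (finite_and_index_facetGroup_le_fiftySeven cellRelations_fiftySevenCell
      fiftySevenCell.isStringRepresentation.closure_eq_top)
    (finite_and_card_facetGroup_le_fiftySeven cellRelations_fiftySevenCell)

end Maniplex

/-! ### Comparison of orders -/

/-- The group `PSL₂(F)` has at least `168` elements if `F` has at least `7`. -/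
theorem false_of_card_projectiveSpecialLinearGroup_le {F : Type*} [Field F] [Finite F] {n : ℕ}
    (h7 : 7 ≤ Nat.card F)
    (h : Nat.card (Matrix.ProjectiveSpecialLinearGroup (Fin 2) F) ≤ n) (hn : n < 168) : False := by
  have h1 := le_two_mul_card_projectiveSpecialLinearGroup_two F
  have h2 : 7 * (7 ^ 2 - 1) ≤ Nat.card F * (Nat.card F ^ 2 - 1) := by gcongr
  omega

/-- A prime that vanishes in `F` is the order of `F`, unless `PSL₂(F)` is large. -/
theorem card_eq_of_card_le {F : Type*} [Field F] [Finite F] {p : ℕ} (hp : p.Prime)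
    (hp0 : (p : F) = 0) {n : ℕ}
    (h : Nat.card (Matrix.ProjectiveSpecialLinearGroup (Fin 2) F) ≤ n)
    (hn : 2 * n < (p + 1) * ((p + 1) ^ 2 - 1)) : Nat.card F = p := by
  have hdvd : p ∣ Nat.card F := by
    have h1 : addOrderOf (1 : F) = p := by
      rcases (Nat.dvd_prime hp).mp (addOrderOf_dvd_of_nsmul_eq_zero (x := (1 : F)) (n := p)
        (by simpa using hp0)) with h | h
      · exact absurd (AddMonoid.addOrderOf_eq_one_iff.mp h) one_ne_zero
      · exact h
    exact h1 ▸ addOrderOf_dvd_natCard _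
  refine le_antisymm ?_ (Nat.le_of_dvd Nat.card_pos hdvd)
  by_contra! hlt
  have h1 := le_two_mul_card_projectiveSpecialLinearGroup_two F
  have h2 : (p + 1) * ((p + 1) ^ 2 - 1) ≤ Nat.card F * (Nat.card F ^ 2 - 1) := by
    have : p + 1 ≤ Nat.card F := hlt
    gcongr
  omega

theorem proposition4p2 {F : Type v} [Field F] [Finite F] (q : ℕ) (hq : Nat.card F = q)
    (M : ReflexibleManiplex.{u} 4)
    (hM : Nonempty (M.Aut ≃* Matrix.ProjectiveSpecialLinearGroup (Fin 2) F))
    (h₀ : Nonempty (M.faceGroup 0 ≃* Equiv.Perm (Fin 4)) ∨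
      Nonempty (M.faceGroup 0 ≃* alternatingGroup (Fin 5)))
    (h₃ : Nonempty (M.faceGroup 3 ≃* Equiv.Perm (Fin 4)) ∨
      Nonempty (M.faceGroup 3 ≃* alternatingGroup (Fin 5))) :
    ((q = 11 ∧ M.IsIsomorphic elevenCell) ∨ (q = 19 ∧ M.IsIsomorphic fiftySevenCell)) ∧
      Nonempty (M.faceGroup 0 ≃* alternatingGroup (Fin 5)) ∧
      Nonempty (M.faceGroup 3 ≃* alternatingGroup (Fin 5)) := by
  obtain ⟨φ⟩ := hM
  choose A hA using fun i => QuotientGroup.mk'_surjective _ (φ (M.ρ i))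
  have hA2 : ∀ i j, toPSL (A i * A j) = φ (M.ρ i * M.ρ j) := fun i j => by
    rw [map_mul, map_mul, hA, hA]
  have hA3 : ∀ i j k, toPSL (A i * A j * A k) = φ (M.ρ i * M.ρ j * M.ρ k) := fun i j k => by
    rw [map_mul, hA2, hA, ← map_mul]
  have hA0 : ∀ i, (A i : Matrix (Fin 2) (Fin 2) F).trace = 0 := fun i =>
    trace_eq_zero_of_sq_eq_one φ (hA i) (M.ρ_ne_one i) (M.ρ_sq i)
  have hA02 : ∀ i j : Fin 4, (i : ℕ) + 1 < j →
      ((A i : Matrix (Fin 2) (Fin 2) F) * (A j : Matrix (Fin 2) (Fin 2) F)).trace = 0 :=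
    fun i j hij => by
      rw [← Matrix.SpecialLinearGroup.coe_mul]
      refine trace_eq_zero_of_sq_eq_one φ (hA2 i j) (M.mul_ne_one ?_) (M.mul_sq_eq_one hij)
      rintro rfl
      omega
  have hgram : (4 - sqTrace (A 0 * A 1)) * (4 - sqTrace (A 2 * A 3)) = 4 * sqTrace (A 1 * A 2) := by
    simp only [sqTrace, Matrix.SpecialLinearGroup.coe_mul]
    exact four_sub_mul_four_sub (A := fun i => (A i : Matrix (Fin 2) (Fin 2) F)) hA0
      (fun i => (A i).det_coe) (hA02 0 2 (by decide)) (hA02 0 3 (by decide)) (hA02 1 3 (by decide))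
  have hfacet : sqTrace (A 0 * A 1) + sqTrace (A 1 * A 2) + sqTrace (A 0 * A 1 * A 2) = 4 := by
    simp only [sqTrace, Matrix.SpecialLinearGroup.coe_mul]
    exact trace_mul_mul_sq (hA0 0) (hA0 1) (hA0 2) (A 0).det_coe (A 1).det_coe (A 2).det_coe
      (hA02 0 2 (by decide))
  have hvertex : sqTrace (A 1 * A 2) + sqTrace (A 2 * A 3) + sqTrace (A 1 * A 2 * A 3) = 4 := by
    simp only [sqTrace, Matrix.SpecialLinearGroup.coe_mul]
    exact trace_mul_mul_sq (hA0 1) (hA0 2) (hA0 3) (A 1).det_coe (A 2).det_coe (A 3).det_coe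
      (hA02 1 3 (by decide))
  have t₃ : CenterlessTriple (M.ρ 0) (M.ρ 1) (M.ρ 2) := by
    rcases h₃ with ⟨⟨e⟩⟩ | ⟨⟨e⟩⟩
    · exact M.centerlessTriple_facet e perm_four_center_eq_bot
    · exact M.centerlessTriple_facet e alternatingGroup_five_center_eq_bot
  have t₀ : CenterlessTriple (M.ρ 1) (M.ρ 2) (M.ρ 3) := by
    rcases h₀ with ⟨⟨e⟩⟩ | ⟨⟨e⟩⟩
    · exact M.centerlessTriple_vertex e perm_four_center_eq_bot
    · exact M.centerlessTriple_vertex e alternatingGroup_five_center_eq_bot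
  obtain ⟨hX, hX3, hX4, hX5⟩ := sqTrace_of_sq_ne_one φ (hA2 0 1) t₃.sq_left_mid_ne_one
  obtain ⟨-, hY3, -, hY5⟩ := sqTrace_of_sq_ne_one φ (hA2 1 2) t₀.sq_left_mid_ne_one
  obtain ⟨hZ, hZ3, hZ4, hZ5⟩ := sqTrace_of_sq_ne_one φ (hA2 2 3) t₀.sq_mid_right_ne_one
  obtain ⟨-, hW3, hW4, hW5⟩ := sqTrace_of_sq_ne_one φ (hA3 0 1 2) t₃.sq_petrie_ne_one
  obtain ⟨-, hV3, hV4, hV5⟩ := sqTrace_of_sq_ne_one φ (hA3 1 2 3) t₀.sq_petrie_ne_one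
  have h2 := two_ne_zero_of_gram hX hZ hgram
  have m₃ : ∀ i : Fin 4, i ≠ 3 → M.ρ i ∈ M.faceGroup 3 := fun i hi =>
    Subgroup.subset_closure ⟨i, hi, rfl⟩
  have m₀ : ∀ i : Fin 4, i ≠ 0 → M.ρ i ∈ M.faceGroup 0 := fun i hi =>
    Subgroup.subset_closure ⟨i, hi, rfl⟩
  have m01 := mul_mem (m₃ 0 (by decide)) (m₃ 1 (by decide))
  have m12 := mul_mem (m₃ 1 (by decide)) (m₃ 2 (by decide))
  have m012 := mul_mem m01 (m₃ 2 (by decide))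
  have n12 := mul_mem (m₀ 1 (by decide)) (m₀ 2 (by decide))
  have n23 := mul_mem (m₀ 2 (by decide)) (m₀ 3 (by decide))
  have n123 := mul_mem n12 (m₀ 3 (by decide))
  have htop := M.isStringRepresentation.closure_eq_top
  have hcard := Nat.card_congr φ.toEquiv
  rcases h₃ with ⟨⟨e₃⟩⟩ | ⟨⟨e₃⟩⟩ <;> rcases h₀ with ⟨⟨e₀⟩⟩ | ⟨⟨e₀⟩⟩
  · exfalso
    have := Finite.of_equiv _ e₃.symm.toEquiv
    have h24 : Finite (M.faceGroup 3) ∧ Nat.card (M.faceGroup 3) ≤ 24 := by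
      refine ⟨this, ?_⟩
      rw [Nat.card_congr e₃.toEquiv, Nat.card_perm, Nat.card_eq_fintype_card, Fintype.card_fin]
      rfl
    rcases octahedral_octahedral h2 (sqTrace_eq_one_or_two φ e₃ m01 (hA2 0 1) t₃.sq_left_mid_ne_one)
      (sqTrace_eq_one_or_two φ e₃ m12 (hA2 1 2) t₃.sq_mid_right_ne_one)
      (sqTrace_eq_one_or_two φ e₃ m012 (hA3 0 1 2) t₃.sq_petrie_ne_one)
      (sqTrace_eq_one_or_two φ e₀ n23 (hA2 2 3) t₀.sq_mid_right_ne_one)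
      (sqTrace_eq_one_or_two φ e₀ n123 (hA3 1 2 3) t₀.sq_petrie_ne_one) hgram hfacet hvertex with
      ⟨eX, eY, eZ, eW, eV⟩ | ⟨eX, eY, eZ, eW, eV⟩
    -- Type `{3, 3, 3}`: at most five cosets of the facet group.
    · have hrel := M.cellRelations (hX3.mpr eX) (hY3.mpr eY) (hZ3.mpr eZ) (hW4.mpr eW) (hV4.mpr eV)
      have hle := card_le_of_card_facet_le M (finite_and_index_facetGroup_le_simplex hrel htop) h24
      exact false_of_card_projectiveSpecialLinearGroup_le
          (seven_le_card_of_sq_eq_two h2 eW) (hcard ▸ hle.2) (by norm_num)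
    -- Type `{4, 3, 4}`: at most four cosets of the facet group.
    · have hrel := M.cellRelations (hX4.mpr eX) (hY3.mpr eY) (hZ4.mpr eZ) (hW3.mpr eW) (hV3.mpr eV)
      have hle := card_le_of_card_facet_le M (finite_and_index_facetGroup_le_cubic hrel htop) h24
      exact false_of_card_projectiveSpecialLinearGroup_le
          (seven_le_card_of_sq_eq_two h2 eX) (hcard ▸ hle.2) (by norm_num)
  · exact (not_octahedral_icosahedral h2
      (sqTrace_eq_one_or_two φ e₃ m01 (hA2 0 1) t₃.sq_left_mid_ne_one)
      (sqTrace_eq_one_or_two φ e₃ m12 (hA2 1 2) t₃.sq_mid_right_ne_one)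
      (sqTrace_eq_one_or_root φ e₀ n12 (hA2 1 2) t₀.sq_left_mid_ne_one)
      (sqTrace_eq_one_or_root φ e₀ n23 (hA2 2 3) t₀.sq_mid_right_ne_one)
      (sqTrace_eq_one_or_root φ e₀ n123 (hA3 1 2 3) t₀.sq_petrie_ne_one) hgram hvertex).elim
  -- The dual of the previous case.
  · refine (not_octahedral_icosahedral h2
      (sqTrace_eq_one_or_two φ e₀ n23 (hA2 2 3) t₀.sq_mid_right_ne_one)
      (sqTrace_eq_one_or_two φ e₀ n12 (hA2 1 2) t₀.sq_left_mid_ne_one)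
      (sqTrace_eq_one_or_root φ e₃ m12 (hA2 1 2) t₃.sq_mid_right_ne_one)
      (sqTrace_eq_one_or_root φ e₃ m01 (hA2 0 1) t₃.sq_left_mid_ne_one)
      (sqTrace_eq_one_or_root φ e₃ m012 (hA3 0 1 2) t₃.sq_petrie_ne_one)
      ((mul_comm _ _).trans hgram) ?_).elim
    rw [add_comm (sqTrace (A 1 * A 2)), hfacet]
  · refine ⟨?_, ⟨e₀⟩, ⟨e₃⟩⟩
    rcases icosahedral_icosahedral h2
      (sqTrace_eq_one_or_root φ e₃ m01 (hA2 0 1) t₃.sq_left_mid_ne_one)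
      (sqTrace_eq_one_or_root φ e₃ m12 (hA2 1 2) t₃.sq_mid_right_ne_one)
      (sqTrace_eq_one_or_root φ e₃ m012 (hA3 0 1 2) t₃.sq_petrie_ne_one)
      (sqTrace_eq_one_or_root φ e₀ n23 (hA2 2 3) t₀.sq_mid_right_ne_one)
      (sqTrace_eq_one_or_root φ e₀ n123 (hA3 1 2 3) t₀.sq_petrie_ne_one) hgram hfacet hvertex with
      ⟨eX, eY, eZ, eW, eV, h11⟩ | ⟨eX, eY, eZ, eW, eV, h19⟩
    · left
      have hrel := M.cellRelations (hX3.mpr eX) (hY5.mpr eY) (hZ3.mpr eZ) (hW5.mpr eW) (hV5.mpr eV)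
      have hle := card_le_of_card_facet_le M (finite_and_index_facetGroup_le_eleven hrel htop)
        (finite_and_card_facetGroup_le_eleven hrel)
      have hF : Nat.card F = 11 :=
        card_eq_of_card_le (by norm_num) (by exact_mod_cast h11) (hcard ▸ hle.2) (by norm_num)
      have hge := le_two_mul_card_projectiveSpecialLinearGroup_two F
      rw [← hcard, hF] at hge
      have := card_elevenCell_le.1
      exact ⟨hq.symm.trans hF, M.isIsomorphic_of_card_le elevenCell (MulEquiv.refl _)
        (fun _ => rfl) hrel (card_elevenCell_le.2.trans (by omega))⟩
    · right
      have hrel := M.cellRelations (hX5.mpr eX) (hY3.mpr eY) (hZ5.mpr eZ) (hW5.mpr eW) (hV5.mpr eV)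
      have hle := card_le_of_card_facet_le M (finite_and_index_facetGroup_le_fiftySeven hrel htop)
        (finite_and_card_facetGroup_le_fiftySeven hrel)
      have hF : Nat.card F = 19 :=
        card_eq_of_card_le (by norm_num) (by exact_mod_cast h19) (hcard ▸ hle.2) (by norm_num)
      have hge := le_two_mul_card_projectiveSpecialLinearGroup_two F
      rw [← hcard, hF] at hge
      have := card_fiftySevenCell_le.1
      exact ⟨hq.symm.trans hF, M.isIsomorphic_of_card_le fiftySevenCell (MulEquiv.refl _)
        (fun _ => rfl) hrel (card_fiftySevenCell_le.2.trans (by omega))⟩
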